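/- Let $J$ be either the real line $\mathbb{R}$ or the unit interval $[0,1)$. A weight on $J$ is a function $w$ that is positive almost everywhere on $J$ and integrable on every bounded interval contained in $J$. For an integer $n\ge 2$, an $n$-adic interval is an interval $[k n^{-t},(k+1)n^{-t})$ with $k,t\in\mathbb{Z}$; its $n$-adic children are the $n$ intervals of the form $[\ell n^{-t-1},(\ell+1)n^{-t-1})$, $\ell \in \mathbb{Z}$, contained in it. The weight $w$ is $n$-adic doubling on $J$ if there is a constant $C$ such that $\int_{Q'}w\le C\int_{Q''}w$ whenever $Q',Q''$ are $n$-adic children of the same $n$-adic interval $Q\subseteq J$. For $r>1$: - $RH_r$ is the class of weights $w$ on $J$ for which there is a constant $C$ such that, for all bounded nondegenerate intervals $I\subseteq J$, $w^r$ is integrable on $I$ and $$\Big(\frac1{|I|}\int_I w^r\Big)^{1/r}\le C\,\frac1{|I|}\int_I w .$$ - $RH_r^n$ is the class of weights $w$ on $J$ that are $n$-adic doubling on $J$ and satisfy the same condition, with the intervals $I$ restricted to the $n$-adic intervals contained in $J$. Put $RH_1=\bigcup_{r>1}RH_r$ and $RH_1^n=\bigcup_{r>1}RH_r^n$. Let $m,n\ge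 2$ be coprime integers. Then, both for $J=\mathbb{R}$ and for $J=[0,1)$, $$RH_r^m\cap RH_r^n\ne RH_r\qquad\text{for every } r>1,$$ and $$RH_1^m\cap RH_1^n\neq RH_1 .$$ -/

import Mathlib

open MeasureTheory Set

noncomputable section

/-- A weight on `J` (here `J` is the real line or the unit interval `[0, 1)`): a function that is
positive almost everywhere on `J` and integrable on every bounded interval contained in `J`. Only
the values on `J` matter. -/
def IsWeightOn (J : Set ℝ) (w : ℝ → ℝ) : Prop :=
  (∀ᵐ x ∂(volume.restrict J), 0 < w x) ∧
    ∀ a b : ℝ, a < b → Ico a b ⊆ J → IntegrableOn w (Ico a b)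

/-- The reverse Hölder inequality on a set `I` with exponent `r` and constant `C`: the power `w ^ r`
is integrable on `I` and `(⨍_I w ^ r) ^ (1 / r) ≤ C ⨍_I w`. -/
def ReverseHolderOn (w : ℝ → ℝ) (r C : ℝ) (I : Set ℝ) : Prop :=
  IntegrableOn (fun x => w x ^ r) I ∧
    (⨍ x in I, w x ^ r) ^ (1 / r) ≤ C * ⨍ x in I, w x

/-- The `n`-adic interval `[k / n ^ t, (k + 1) / n ^ t)`, with `t` and `k` arbitrary integers. -/
def adicInterval (n : ℕ) (t k : ℤ) : Set ℝ :=
  Ico ((k : ℝ) / (n : ℝ) ^ t) (((k : ℝ) + 1) / (n : ℝ) ^ t)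

/-- The measure `w dx` is `n`-adic doubling on `J`: for every `n`-adic interval contained in `J`,
the masses of any two of its `n` children are comparable, with a uniform constant. The children of
`adicInterval n t k` are `adicInterval n (t + 1) (n * k + i)` for `0 ≤ i < n`. -/
def IsAdicDoublingOn (n : ℕ) (J : Set ℝ) (w : ℝ → ℝ) : Prop :=
  ∃ C : ℝ, ∀ t k : ℤ, adicInterval n t k ⊆ J → ∀ i j : ℕ, i < n → j < n →
    ∫ x in adicInterval n (t + 1) ((n : ℤ) * k + (i : ℤ)), w x ≤
      C * ∫ x in adicInterval n (t + 1) ((n : ℤ) * k + (j : ℤ)), w x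

/-- The class `RH_r` on `J`: all bounded intervals contained in `J` are tested. (Changing the end
points of an interval does not affect the averages.) -/
def RH (J : Set ℝ) (r : ℝ) : Set (ℝ → ℝ) :=
  {w | IsWeightOn J w ∧
    ∃ C : ℝ, ∀ a b : ℝ, a < b → Ico a b ⊆ J → ReverseHolderOn w r C (Ico a b)}

/-- The class `RH_r^n` on `J`: only `n`-adic intervals contained in `J` are tested, and `w` is
required to be `n`-adic doubling. -/
def RHAdic (n : ℕ) (J : Set ℝ) (r : ℝ) : Set (ℝ → ℝ) :=
  {w | IsWeightOn J w ∧ IsAdicDoublingOn n J w ∧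
    ∃ C : ℝ, ∀ t k : ℤ, adicInterval n t k ⊆ J → ReverseHolderOn w r C (adicInterval n t k)}

/-- `RH_1`, the union of the classes `RH_r` over all `r > 1`. -/
def RHOne (J : Set ℝ) : Set (ℝ → ℝ) :=
  ⋃ r ∈ Ioi (1 : ℝ), RH J r

/-- `RH_1^n`, the union of the classes `RH_r^n` over all `r > 1`. -/
def RHAdicOne (n : ℕ) (J : Set ℝ) : Set (ℝ → ℝ) :=
  ⋃ r ∈ Ioi (1 : ℝ), RHAdic n J r

end

/-!
For integers `m, n ≥ 2`, a single weight `w`, with values in `(0, 1]`, lies in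
both adic classes for every exponent `r > 1` and in none of the classes `RH J r`.

An `n`-adic interval in `(0, ∞)` never has a power `n ^ (-a)` in its interior
(`adicInterval_side`), so an `n`-adic class cannot compare the behaviour of a weight on the two
sides of such a point. By Dirichlet's theorem (`exists_close_powers`) there are points `p`,
arbitrarily close to `0`, such that a power `n ^ (-a)` and a power `m ^ (-b)` both lie in
`[p, (1 + η / 8) p]` with `η` as small as desired. Around `p`, the weight is a bump: with `d` the
distance to `p` divided by `p / 8`, it is `d` on the left and `d ^ 2` on the right, truncated to
`[η, 1]`. The truncation makes the bump constant at the scale of the gap between the two powers, so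
each `m`-adic or `n`-adic interval in `(0, ∞)` sees, up to constants, only the left or only the
right profile. Each profile alone increases polynomially away from `p`, so on such an interval the
supremum of `w` is bounded by a multiple of its average over any child (`IsAdicFlat`), which gives
adic doubling and all adic reverse Hölder inequalities at once (`IsAdicFlat.mem_RHAdic`).

On the other hand, for `η = ρ ^ 4` the interval from `d = ρ ^ 3` on the left to `d = ρ ^ 2` on the
right has an average of order `ρ ^ 4`, while values of order `ρ ^ 3` are taken on a proportion `ρ`
of it. The reverse Hölder constant is then at least of order `ρ ^ (1 / r - 1)`
(`ReverseHolderOn.le_of_eqOn_bump`). The weight combines bumps with `ρ → 0` at a lacunary sequence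
of points, so that an interval `[c, d)` with `d ≤ 2c` meets at most one of them. The adic intervals
with left end point `0`, which meet infinitely many bumps, are treated separately; on the negative
half-line `w = 1`.
-/

/-- The bump at `p`: equal to `1` at distance at least `p / 8` from `p`, decaying linearly to the
floor `η` on the left of `p` and quadratically on the right. -/
noncomputable def bump (p η z : ℝ) : ℝ :=
  max η (min 1 (if z < p then (p - z) / (p / 8) else ((z - p) / (p / 8)) ^ 2))

/-- The infimum of the bumps at the points `p k`, with floors `η k`. -/
noncomputable def bumpWeight (p η : ℕ → ℝ) (z : ℝ) : ℝ := ⨅ k, bump (p k) (η k) z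

/-- A quantitative comparison of suprema and averages: every child of an `n`-adic interval `I`
contains an interval of length at least `κ |I|` on which `w` is at least `κ` times an upper bound
`M` of `w` on `I`. -/
def IsAdicFlat (n : ℕ) (w : ℝ → ℝ) (κ : ℝ) : Prop :=
  ∀ t k : ℤ, ∃ M : ℝ, (∀ z ∈ adicInterval n t k, w z ≤ M) ∧ ∀ i : ℕ, i < n →
    ∃ e f : ℝ, Ico e f ⊆ adicInterval n (t + 1) ((n : ℤ) * k + (i : ℤ)) ∧
      κ * (1 / (n : ℝ) ^ t) ≤ f - e ∧ ∀ z ∈ Ico e f, κ * M ≤ w z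

/-! ### Adic intervals -/

lemma adicInterval_eq (n : ℕ) (t k : ℤ) :
    adicInterval n t k = Ico (k * (1 / (n : ℝ) ^ t)) ((k + 1) * (1 / (n : ℝ) ^ t)) := by
  simp only [adicInterval, mul_one_div]

lemma adicInterval_child_eq {n : ℕ} (hn : 2 ≤ n) (t k : ℤ) (i : ℕ) :
    adicInterval n (t + 1) ((n : ℤ) * k + (i : ℤ)) =
      Ico (k * (1 / (n : ℝ) ^ t) + i * (1 / (n : ℝ) ^ t / n))
        (k * (1 / (n : ℝ) ^ t) + (i + 1) * (1 / (n : ℝ) ^ t / n)) := by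
  have h0 : (n : ℝ) ≠ 0 := by positivity
  have h1 : (n : ℝ) ^ t ≠ 0 := zpow_ne_zero _ h0
  simp only [adicInterval, zpow_add_one₀ h0]
  push_cast
  congr 1
  · field_simp
  · field_simp
    ring

lemma adicInterval_child_subset {n : ℕ} (hn : 2 ≤ n) (t k : ℤ) {i : ℕ} (hi : i < n) :
    adicInterval n (t + 1) ((n : ℤ) * k + (i : ℤ)) ⊆ adicInterval n t k := by
  rw [adicInterval_child_eq hn, adicInterval_eq]
  have h0 : (0 : ℝ) < n := by positivity
  have h1 : (0 : ℝ) < 1 / (n : ℝ) ^ t := by positivity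
  have h2 : ((i : ℝ) + 1) ≤ n := by exact_mod_cast hi
  apply Ico_subset_Ico
  · have : 0 ≤ (i : ℝ) * (1 / (n : ℝ) ^ t / n) := by positivity
    linarith
  · have : ((i : ℝ) + 1) * (1 / (n : ℝ) ^ t / n) ≤ n * (1 / (n : ℝ) ^ t / n) := by gcongr
    rw [mul_div_cancel₀ _ h0.ne'] at this
    linarith

/-- An `n`-adic interval on the positive half-line does not have `n ^ (-a)` in its interior: this
holds by nesting if it is short, and otherwise because its left end point is at least its length. -/
lemma adicInterval_side {n : ℕ} (hn : 2 ≤ n) (t : ℤ) {k : ℤ} (hk : 1 ≤ k) (a : ℕ) :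
    1 / (n : ℝ) ^ a ≤ k * (1 / (n : ℝ) ^ t) ∨ (k + 1) * (1 / (n : ℝ) ^ t) ≤ 1 / (n : ℝ) ^ a := by
  have h0 : (0 : ℝ) < n := by positivity
  have hn' : (1 : ℝ) ≤ n := by exact_mod_cast (by omega : 1 ≤ n)
  have hk' : (1 : ℝ) ≤ k := by exact_mod_cast hk
  have ht : (0 : ℝ) < 1 / (n : ℝ) ^ t := by positivity
  rcases le_total t a with h | h
  · left
    have h1 : 1 / (n : ℝ) ^ a ≤ 1 / (n : ℝ) ^ t := by
      rw [← zpow_natCast (n : ℝ) a]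
      exact one_div_le_one_div_of_le (by positivity) (zpow_le_zpow_right₀ hn' h)
    nlinarith
  · obtain ⟨d, hd⟩ := Int.le.dest h
    have e : 1 / (n : ℝ) ^ a = n ^ d * (1 / (n : ℝ) ^ t) := by
      rw [← hd, zpow_add₀ h0.ne', zpow_natCast, zpow_natCast]
      field_simp
    rw [e]
    rcases lt_or_ge k ((n : ℤ) ^ d) with h | h
    · right
      have : (k : ℝ) + 1 ≤ (n : ℝ) ^ d := by exact_mod_cast h
      gcongr
    · left
      have : (n : ℝ) ^ d ≤ k := by exact_mod_cast h
      gcongr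

/-! ### Flat weights satisfy adic reverse Hölder inequalities -/

lemma setIntegral_Ico_le {w : ℝ → ℝ} {a b M : ℝ} (hab : a ≤ b) (hw : ∀ z ∈ Ico a b, w z ≤ M)
    (hint : IntegrableOn w (Ico a b)) : ∫ x in Ico a b, w x ≤ M * (b - a) := by
  have h := setIntegral_mono_on hint (integrableOn_const (C := M) (by simp)) measurableSet_Ico hw
  rw [setIntegral_const, Real.volume_real_Ico_of_le hab, smul_eq_mul] at h
  linarith

lemma le_setIntegral_Ico {w : ℝ → ℝ} {a b e f c : ℝ} (hef : e ≤ f) (hsub : Ico e f ⊆ Ico a b)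
    (h0 : ∀ z, 0 ≤ w z) (hw : ∀ z ∈ Ico e f, c ≤ w z)
    (hint : IntegrableOn w (Ico a b)) : c * (f - e) ≤ ∫ x in Ico a b, w x := by
  have h := setIntegral_mono_on (integrableOn_const (C := c) (by simp)) (hint.mono_set hsub)
    measurableSet_Ico hw
  rw [setIntegral_const, Real.volume_real_Ico_of_le hef, smul_eq_mul] at h
  have h2 := setIntegral_mono_set (f := w) hint (ae_of_all _ h0) (hsub.eventuallyLE)
  linarith

lemma setAverage_Ico {a b : ℝ} (hab : a < b) (w : ℝ → ℝ) :
    ⨍ x in Ico a b, w x = (b - a)⁻¹ * ∫ x in Ico a b, w x := by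
  rw [setAverage_eq, Real.volume_real_Ico_of_le hab.le, smul_eq_mul]

lemma integrableOn_Ico_of_le_one {w : ℝ → ℝ} (hm : Measurable w) (h0 : ∀ z, 0 < w z)
    (h1 : ∀ z, w z ≤ 1) (a b : ℝ) : IntegrableOn w (Ico a b) :=
  Measure.integrableOn_of_bounded (M := 1) (by simp) hm.aestronglyMeasurable
    (ae_of_all _ fun z => by rw [Real.norm_of_nonneg (h0 z).le]; exact h1 z)

lemma integrableOn_rpow_Ico_of_le_one {w : ℝ → ℝ} (hm : Measurable w) (h0 : ∀ z, 0 < w z)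
    (h1 : ∀ z, w z ≤ 1) {r : ℝ} (hr : 0 ≤ r) (a b : ℝ) :
    IntegrableOn (fun x => w x ^ r) (Ico a b) :=
  integrableOn_Ico_of_le_one (hm.pow_const r) (fun z => Real.rpow_pos_of_pos (h0 z) r)
    (fun z => Real.rpow_le_one (h0 z).le (h1 z) hr) a b

lemma isWeightOn_of_le_one {w : ℝ → ℝ} (hm : Measurable w) (h0 : ∀ z, 0 < w z)
    (h1 : ∀ z, w z ≤ 1) (J : Set ℝ) : IsWeightOn J w :=
  ⟨ae_of_all _ h0, fun a b _ _ => integrableOn_Ico_of_le_one hm h0 h1 a b⟩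

theorem IsAdicFlat.mem_RHAdic {n : ℕ} (hn : 2 ≤ n) {w : ℝ → ℝ} {κ : ℝ} (hκ : 0 < κ)
    (hf : IsAdicFlat n w κ) (hm : Measurable w) (h0 : ∀ z, 0 < w z) (h1 : ∀ z, w z ≤ 1)
    (J : Set ℝ) {r : ℝ} (hr : 1 < r) : w ∈ RHAdic n J r := by
  have hn0 : (0 : ℝ) < n := by positivity
  have hn1 : (1 : ℝ) ≤ n := by exact_mod_cast (by omega : 1 ≤ n)
  have key : ∀ t k : ℤ, ∃ M : ℝ, 0 < M ∧ (∀ z ∈ adicInterval n t k, w z ≤ M) ∧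
      ∀ i : ℕ, i < n → κ ^ 2 * M * (1 / (n : ℝ) ^ t) ≤
        ∫ x in adicInterval n (t + 1) ((n : ℤ) * k + (i : ℤ)), w x := by
    intro t k
    obtain ⟨M, hM, hi⟩ := hf t k
    have hh : (0 : ℝ) < 1 / (n : ℝ) ^ t := by positivity
    have hM0 : 0 < M := by
      refine (h0 _).trans_le (hM (k * (1 / (n : ℝ) ^ t)) ?_)
      rw [adicInterval_eq]
      exact ⟨le_rfl, by nlinarith⟩
    refine ⟨M, hM0, hM, fun i hin => ?_⟩
    obtain ⟨e, f, hs, hl, hw⟩ := hi i hin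
    have hef : 0 < f - e := lt_of_lt_of_le (by positivity) hl
    rw [adicInterval_child_eq hn] at hs ⊢
    have h := le_setIntegral_Ico (by linarith) hs (fun z => (h0 z).le) hw
      (integrableOn_Ico_of_le_one hm h0 h1 _ _)
    refine le_trans ?_ h
    calc κ ^ 2 * M * (1 / (n : ℝ) ^ t) = κ * M * (κ * (1 / (n : ℝ) ^ t)) := by ring
      _ ≤ _ := by gcongr
  refine ⟨isWeightOn_of_le_one hm h0 h1 J, ⟨1 / κ ^ 2, fun t k _ i j hi hj => ?_⟩,
    ⟨1 / κ ^ 2, fun t k _ => ?_⟩⟩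
  · obtain ⟨M, hM0, hM, hc⟩ := key t k
    have hh : (0 : ℝ) < 1 / (n : ℝ) ^ t := by positivity
    have hle : ∫ x in adicInterval n (t + 1) ((n : ℤ) * k + (i : ℤ)), w x
        ≤ M * (1 / (n : ℝ) ^ t) := by
      have hs := adicInterval_child_subset hn t k hi
      rw [adicInterval_child_eq hn] at hs ⊢
      have hhn : 0 < 1 / (n : ℝ) ^ t / n := by positivity
      refine (setIntegral_Ico_le (by nlinarith) (fun z hz => hM z (hs hz))
        (integrableOn_Ico_of_le_one hm h0 h1 _ _)).trans ?_
      have : 1 / (n : ℝ) ^ t / n ≤ 1 / (n : ℝ) ^ t := div_le_self hh.le hn1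
      have := mul_le_mul_of_nonneg_left this hM0.le
      linarith
    have := hc j hj
    rw [one_div_mul_eq_div, le_div_iff₀ (by positivity)]
    nlinarith [sq_nonneg κ]
  · obtain ⟨M, hM0, hM, hc⟩ := key t k
    have hh : (0 : ℝ) < 1 / (n : ℝ) ^ t := by positivity
    have hle : κ ^ 2 * M * (1 / (n : ℝ) ^ t) ≤ ∫ x in adicInterval n t k, w x := by
      refine (hc 0 (by omega)).trans ?_
      have hs := adicInterval_child_subset hn t k (i := 0) (by omega)
      rw [adicInterval_eq n t k] at hs ⊢
      exact setIntegral_mono_set (integrableOn_Ico_of_le_one hm h0 h1 _ _)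
        (ae_of_all _ fun z => (h0 z).le) (hs.eventuallyLE)
    rw [adicInterval_eq] at hM hle ⊢
    have hab : (k : ℝ) * (1 / (n : ℝ) ^ t) < (k + 1) * (1 / (n : ℝ) ^ t) := by nlinarith
    have hlen : ((k : ℝ) + 1) * (1 / (n : ℝ) ^ t) - k * (1 / (n : ℝ) ^ t) = 1 / (n : ℝ) ^ t := by
      ring
    have hint := integrableOn_rpow_Ico_of_le_one hm h0 h1 (r := r) (by linarith)
      (k * (1 / (n : ℝ) ^ t)) ((k + 1) * (1 / (n : ℝ) ^ t))
    refine ⟨hint, ?_⟩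
    rw [setAverage_Ico hab, setAverage_Ico hab, hlen]
    have h2 : ∫ x in Ico (k * (1 / (n : ℝ) ^ t)) ((k + 1) * (1 / (n : ℝ) ^ t)), w x ^ r ≤
        M ^ r * (1 / (n : ℝ) ^ t) := by
      have := setIntegral_Ico_le hab.le
        (fun z hz => Real.rpow_le_rpow (h0 z).le (hM z hz) (by linarith : 0 ≤ r)) hint
      rwa [hlen] at this
    have h3 : 0 ≤ ∫ x in Ico (k * (1 / (n : ℝ) ^ t)) ((k + 1) * (1 / (n : ℝ) ^ t)), w x ^ r :=
      integral_nonneg fun z => (Real.rpow_pos_of_pos (h0 z) r).le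
    calc _ ≤ (M ^ r) ^ (1 / r) := by
          apply Real.rpow_le_rpow (by positivity) _ (by positivity)
          rw [inv_mul_le_iff₀ hh]; linarith
      _ = M := by
          rw [← Real.rpow_mul hM0.le, mul_one_div_cancel (by linarith), Real.rpow_one]
      _ ≤ _ := by
          rw [one_div_mul_eq_div, le_div_iff₀ (by positivity), ← div_eq_inv_mul, le_div_iff₀ hh]
          linarith

/-! ### A single bump -/

lemma floor_le_bump (p η z : ℝ) : η ≤ bump p η z := le_max_left _ _

lemma bump_le_one (p : ℝ) {η : ℝ} (hη : η ≤ 1) (z : ℝ) : bump p η z ≤ 1 :=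
  max_le hη (min_le_left _ _)

lemma bump_of_lt {p z : ℝ} (η : ℝ) (h : z < p) :
    bump p η z = max η (min 1 ((p - z) / (p / 8))) := by
  simp only [bump, if_pos h]

lemma bump_of_le {p z : ℝ} (η : ℝ) (h : p ≤ z) :
    bump p η z = max η (min 1 (((z - p) / (p / 8)) ^ 2)) := by
  simp only [bump, if_neg h.not_gt]

lemma measurable_bump (p η : ℝ) : Measurable (bump p η) := by
  unfold bump
  refine measurable_const.max (measurable_const.min ?_)
  exact Measurable.ite measurableSet_Iio (by fun_prop) (by fun_prop)

lemma bump_eq_one {p η z : ℝ} (hp : 0 < p) (hη : η ≤ 1) (h : p / 8 ≤ |z - p|) :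
    bump p η z = 1 := by
  refine le_antisymm (bump_le_one p hη z) ?_
  rcases lt_or_ge z p with hz | hz
  · rw [bump_of_lt _ hz]
    rw [abs_of_neg (by linarith)] at h
    have : 1 ≤ (p - z) / (p / 8) := by rw [le_div_iff₀ (by positivity)]; linarith
    exact le_max_of_le_right (le_min le_rfl this)
  · rw [bump_of_le _ hz]
    rw [abs_of_nonneg (by linarith)] at h
    have : 1 ≤ (z - p) / (p / 8) := by rw [le_div_iff₀ (by positivity)]; linarith
    exact le_max_of_le_right (le_min le_rfl (one_le_pow₀ this))

/-- Up to and slightly beyond `p` the quadratic branch stays below the floor, so that the bump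
follows the truncated linear profile. -/
lemma bump_eq_left {p η z : ℝ} (hp : 0 < p) (h0 : 0 < η) (h1 : η ≤ 1) (hz : z ≤ p + η * (p / 8)) :
    bump p η z = max η (min 1 ((p - z) / (p / 8))) := by
  rcases lt_or_ge z p with h | h
  · exact bump_of_lt _ h
  · rw [bump_of_le _ h]
    have ha : (z - p) / (p / 8) ≤ η := by rw [div_le_iff₀ (by positivity)]; linarith
    have hb : 0 ≤ (z - p) / (p / 8) := div_nonneg (by linarith) (by positivity)
    have hc : (p - z) / (p / 8) ≤ 0 := div_nonpos_of_nonpos_of_nonneg (by linarith) (by positivity)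
    rw [max_eq_left (min_le_of_right_le (by nlinarith)),
      max_eq_left (min_le_of_right_le (by linarith))]

/-- Comparison of two values of a truncated profile. -/
lemma max_min_one_le {η u v K : ℝ} (h0 : 0 < η) (hK : 1 ≤ K)
    (h : u ≤ K * (v + η)) : max η (min 1 u) ≤ 2 * K * max η (min 1 v) := by
  set y := max η (min 1 v) with hy
  have hη : η ≤ y := le_max_left _ _
  have hy0 : 0 < y := h0.trans_le hη
  have hyK : y ≤ 2 * K * y := by nlinarith
  refine max_le (hη.trans hyK) ?_
  rcases le_total 1 v with hv | hv
  · have : 1 ≤ y := le_max_of_le_right (le_min le_rfl hv)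
    exact (min_le_left _ _).trans (this.trans hyK)
  · have : v ≤ y := le_max_of_le_right (le_min hv le_rfl)
    refine (min_le_right _ _).trans (h.trans ?_)
    nlinarith

/-- On an interval lying to the left of `p + η p / 8`, or to the right of `p`, a bump is comparable
to its supremum on half of every subinterval of proportional length. -/
lemma bump_flat {p η a b N : ℝ} (hp : 0 < p) (h0 : 0 < η) (h1 : η ≤ 1) (hN : 1 ≤ N)
    (hside : b ≤ p + η * (p / 8) ∨ p ≤ a) (hab : a < b) :
    ∃ M : ℝ, (∀ z ∈ Ico a b, bump p η z ≤ M) ∧ ∀ c d : ℝ, a ≤ c → d ≤ b → b - a ≤ N * (d - c) →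
      ∃ e f : ℝ, c ≤ e ∧ f ≤ d ∧ f - e = (d - c) / 2 ∧
        ∀ z ∈ Ico e f, 1 / (2 * (2 * N + 1) ^ 2) * M ≤ bump p η z := by
  have hL : 0 < p / 8 := by positivity
  rcases hside with hb | ha
  · refine ⟨max η (min 1 ((p - a) / (p / 8))), fun z hz => ?_, fun c d hc hd hl =>
      ⟨c, (c + d) / 2, le_rfl, ?_, by ring, fun z hz => ?_⟩⟩
    · rw [bump_eq_left hp h0 h1 (hz.2.le.trans hb)]
      gcongr
      exact hz.1
    · nlinarith
    · have hcd : 0 < d - c := by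
        by_contra h
        nlinarith
      rw [bump_eq_left hp h0 h1 (by linarith [hz.2])]
      have key : (p - a) / (p / 8) ≤ (2 * N + 1) * ((p - z) / (p / 8) + η) := by
        rw [div_add' _ _ _ hL.ne', ← mul_div_assoc]
        gcongr
        have hz2 := hz.2
        have : (d - c) / 2 ≤ p + η * (p / 8) - z := by linarith
        have h2 : 0 ≤ η * (p / 8) := by positivity
        nlinarith [hz.1]
      have h3 := max_min_one_le h0 (by linarith) key
      have hy0 : 0 < max η (min 1 ((p - z) / (p / 8))) := lt_max_of_lt_left h0
      rw [one_div_mul_eq_div, div_le_iff₀ (by positivity)]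
      refine h3.trans ?_
      rw [mul_comm]
      gcongr
      nlinarith
  · refine ⟨bump p η b, fun z hz => ?_, fun c d hc hd hl =>
      ⟨(c + d) / 2, d, ?_, le_rfl, by ring, fun z hz => ?_⟩⟩
    · rw [bump_of_le _ (ha.trans hz.1), bump_of_le _ (ha.trans hab.le)]
      have := hz.2.le
      have : 0 ≤ z - p := by linarith [hz.1]
      gcongr
    · nlinarith
    · have hcd : 0 < d - c := by
        by_contra h
        nlinarith
      have hz1 := hz.1
      have hpz : p ≤ z := by linarith
      rw [bump_of_le _ hpz, bump_of_le _ (ha.trans hab.le)]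
      have key : (b - p) / (p / 8) ≤ (2 * N + 1) * ((z - p) / (p / 8)) := by
        rw [← mul_div_assoc]
        gcongr
        have : (d - c) / 2 ≤ z - a := by linarith
        nlinarith
      have key2 : ((b - p) / (p / 8)) ^ 2 ≤
          (2 * N + 1) ^ 2 * (((z - p) / (p / 8)) ^ 2 + η) := by
        have : 0 ≤ (b - p) / (p / 8) := div_nonneg (by linarith) hL.le
        calc _ ≤ ((2 * N + 1) * ((z - p) / (p / 8))) ^ 2 := by gcongr
          _ = (2 * N + 1) ^ 2 * ((z - p) / (p / 8)) ^ 2 := by ring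
          _ ≤ _ := by gcongr; linarith
      have h3 := max_min_one_le h0 (one_le_pow₀ (by linarith)) key2
      rw [one_div_mul_eq_div, div_le_iff₀ (by positivity)]
      linarith

lemma bump_ge_of_far {p η z N : ℝ} (hp : 0 < p) (hN : 1 ≤ N) (h : p ≤ 8 * (N * |z - p|)) :
    1 / N ^ 2 ≤ bump p η z := by
  have hN2 : 1 / N ^ 2 ≤ 1 := by
    rw [div_le_one (by positivity)]; exact one_le_pow₀ hN
  have hN3 : 1 / N ^ 2 ≤ 1 / N := by
    apply one_div_le_one_div_of_le (by positivity); nlinarith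
  rcases lt_or_ge z p with hz | hz
  · rw [bump_of_lt _ hz]
    rw [abs_of_neg (by linarith)] at h
    refine le_max_of_le_right (le_min hN2 (hN3.trans ?_))
    rw [div_le_div_iff₀ (by positivity) (by positivity)]; linarith
  · rw [bump_of_le _ hz]
    rw [abs_of_nonneg (by linarith)] at h
    refine le_max_of_le_right (le_min hN2 ?_)
    rw [← one_div_pow]
    have : 1 / N ≤ (z - p) / (p / 8) := by
      rw [div_le_div_iff₀ (by positivity) (by positivity)]; linarith
    exact pow_le_pow_left₀ (by positivity) this 2

/-- Most of an interval is far from `p`. -/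
lemma exists_quarter_bump_ge {p η c d N : ℝ} (hp : 0 < p) (h1 : η ≤ 1) (hN : 1 ≤ N)
    (hcd : c < d) (hd : d ≤ N * (d - c)) :
    ∃ e f : ℝ, c ≤ e ∧ f ≤ d ∧ f - e = (d - c) / 4 ∧
      ∀ z ∈ Ico e f, 1 / N ^ 2 ≤ bump p η z := by
  have far : ∀ z ∈ Ico c d, (d - c) / 4 ≤ |z - p| → 1 / N ^ 2 ≤ bump p η z := by
    intro z hz h
    rcases le_or_gt (p / 8) |z - p| with h8 | h8
    · rw [bump_eq_one hp h1 h8, div_le_one (by positivity)]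
      exact one_le_pow₀ hN
    · refine bump_ge_of_far hp hN ?_
      have := (abs_lt.1 h8).1
      have : p ≤ 2 * d := by linarith [hz.2]
      nlinarith
  rcases le_total p ((c + d) / 2) with h | h
  · refine ⟨d - (d - c) / 4, d, by linarith, le_rfl, by ring, fun z hz => ?_⟩
    refine far z ⟨by linarith [hz.1], hz.2⟩ ?_
    refine le_trans ?_ (le_abs_self _)
    linarith [hz.1]
  · refine ⟨c, c + (d - c) / 4, le_rfl, by linarith, by ring, fun z hz => ?_⟩
    refine far z ⟨hz.1, by linarith [hz.2]⟩ ?_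
    refine le_trans ?_ (neg_le_abs _)
    linarith [hz.2]

/-! ### The weight -/

section Weight

variable {p η : ℕ → ℝ}

lemma bddBelow_bump (hη0 : ∀ k, 0 < η k) (z : ℝ) :
    BddBelow (range fun k => bump (p k) (η k) z) :=
  ⟨0, by rintro _ ⟨k, rfl⟩; exact (hη0 k).le.trans (floor_le_bump _ _ _)⟩

lemma bumpWeight_eq_bump (hη0 : ∀ k, 0 < η k) (hη1 : ∀ k, η k ≤ 1) {k : ℕ} {z : ℝ}
    (h : ∀ l, l ≠ k → bump (p l) (η l) z = 1) : bumpWeight p η z = bump (p k) (η k) z := by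
  refine le_antisymm (ciInf_le (bddBelow_bump hη0 z) k) (le_ciInf fun l => ?_)
  rcases eq_or_ne l k with rfl | hl
  · exact le_rfl
  · rw [h l hl]
    exact bump_le_one _ (hη1 k) _

/-- By lacunarity, an interval `[c, d)` with `d ≤ 2c` meets the support of at most one bump. -/
lemma bumpWeight_eqOn (hp : ∀ k, 0 < p k) (hlac : ∀ k l, k < l → p l ≤ p k / 4)
    (hη0 : ∀ k, 0 < η k) (hη1 : ∀ k, η k ≤ 1) {c d : ℝ} (hd : d ≤ 2 * c) :
    ∃ k, ∀ z ∈ Ico c d, bumpWeight p η z = bump (p k) (η k) z := by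
  have one : ∀ l z, ¬ |z - p l| < p l / 8 → bump (p l) (η l) z = 1 := fun l z h =>
    bump_eq_one (hp l) (hη1 l) (not_lt.1 h)
  have sep : ∀ k l, k < l → ∀ y ∈ Ico c d, ∀ z ∈ Ico c d, |y - p k| < p k / 8 →
      |z - p l| < p l / 8 → False := by
    intro k l hkl y hy z hz hk hl
    have := hlac k l hkl
    have := (abs_lt.1 hk).1
    have := (abs_lt.1 hl).2
    linarith [hy.2, hz.1, hp k, hp l]
  by_cases h : ∃ k, ∃ y ∈ Ico c d, |y - p k| < p k / 8
  · obtain ⟨k, y, hy, hk⟩ := h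
    refine ⟨k, fun z hz => bumpWeight_eq_bump hη0 hη1 fun l hl => one l z fun hz' => ?_⟩
    rcases lt_or_gt_of_ne hl with h | h
    · exact sep l k h z hz y hy hz' hk
    · exact sep k l h y hy z hz hk hz'
  · push Not at h
    exact ⟨0, fun z hz => bumpWeight_eq_bump hη0 hη1 fun l _ => one l z (h l z hz).not_gt⟩

lemma bumpWeight_of_nonpos (hp : ∀ k, 0 < p k) (hη1 : ∀ k, η k ≤ 1) {z : ℝ} (hz : z ≤ 0) :
    bumpWeight p η z = 1 := by
  have (k : ℕ) : bump (p k) (η k) z = 1 := by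
    refine bump_eq_one (hp k) (hη1 k) ?_
    have := neg_le_abs (z - p k)
    linarith [hp k]
  simp only [bumpWeight, this, ciInf_const]

lemma bumpWeight_le_one (hη0 : ∀ k, 0 < η k) (hη1 : ∀ k, η k ≤ 1) (z : ℝ) :
    bumpWeight p η z ≤ 1 :=
  (ciInf_le (bddBelow_bump hη0 z) 0).trans (bump_le_one _ (hη1 0) _)

lemma bumpWeight_pos (hp : ∀ k, 0 < p k) (hlac : ∀ k l, k < l → p l ≤ p k / 4)
    (hη0 : ∀ k, 0 < η k) (hη1 : ∀ k, η k ≤ 1) (z : ℝ) : 0 < bumpWeight p η z := by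
  rcases le_or_gt z 0 with hz | hz
  · rw [bumpWeight_of_nonpos hp hη1 hz]; exact one_pos
  · obtain ⟨k, hk⟩ := bumpWeight_eqOn hp hlac hη0 hη1 (le_refl (2 * z))
    rw [hk z ⟨le_rfl, by linarith⟩]
    exact (hη0 k).trans_le (floor_le_bump _ _ _)

lemma measurable_bumpWeight : Measurable (bumpWeight p η) :=
  Measurable.iInf fun k => measurable_bump (p k) (η k)

/-- If each `p k` is very close to some power `n ^ (-a)`, the weight is flat on `n`-adic
intervals: none of those on the positive half-line contains points well to the left of `p k` as
well as points well to the right of it. -/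
theorem isAdicFlat_bumpWeight (hp : ∀ k, 0 < p k) (hlac : ∀ k l, k < l → p l ≤ p k / 4)
    (hη0 : ∀ k, 0 < η k) (hη1 : ∀ k, η k ≤ 1) {n : ℕ} (hn : 2 ≤ n)
    (hx : ∀ k, ∃ a : ℕ, p k ≤ 1 / (n : ℝ) ^ a ∧ 1 / (n : ℝ) ^ a ≤ p k + η k * (p k / 8)) :
    IsAdicFlat n (bumpWeight p η) (1 / (2 * (2 * (n : ℝ) + 1) ^ 2)) := by
  intro t k
  have hn2 : (2 : ℝ) ≤ n := by exact_mod_cast hn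
  have hn0 : (0 : ℝ) < n := by positivity
  set κ : ℝ := 1 / (2 * (2 * (n : ℝ) + 1) ^ 2) with hκ
  set h : ℝ := 1 / (n : ℝ) ^ t with hh
  have hh0 : 0 < h := by positivity
  set h' : ℝ := h / n with hh'
  have hh'0 : 0 < h' := by positivity
  have hnh : h = n * h' := by rw [hh', mul_div_cancel₀ _ hn0.ne']
  have hκ4 : κ ≤ 1 / (2 : ℝ) ^ 2 := one_div_le_one_div_of_le (by positivity) (by nlinarith)
  have hκn : κ ≤ 1 / (n : ℝ) ^ 2 := one_div_le_one_div_of_le (by positivity) (by nlinarith)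
  have hκh : κ * h ≤ h' / 8 := by
    have : κ * n ≤ 1 / 8 := by
      rw [hκ, one_div_mul_eq_div, div_le_iff₀ (by positivity)]
      nlinarith
    rw [hnh]
    nlinarith
  rcases lt_trichotomy k 0 with hk | rfl | hk
  · have hk1 : (k : ℝ) + 1 ≤ 0 := by exact_mod_cast hk
    refine ⟨1, fun z _ => bumpWeight_le_one hη0 hη1 z, fun i hi => ?_⟩
    have hs := adicInterval_child_subset hn t k hi
    rw [adicInterval_child_eq hn, adicInterval_eq] at *
    refine ⟨_, _, subset_rfl, ?_, fun z hz => ?_⟩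
    · linarith
    · have : z ≤ 0 := (hs hz).2.le.trans (by nlinarith)
      rw [bumpWeight_of_nonpos hp hη1 this]
      linarith
  · -- The interval `[0, n ^ (-t))` contains infinitely many bumps. Each child contains an interval
    -- `[c, d)` with `d ≤ 2c` of comparable length, and there only one bump matters.
    refine ⟨1, fun z _ => bumpWeight_le_one hη0 hη1 z, fun i hi => ?_⟩
    rw [adicInterval_child_eq hn]
    have main : ∀ c d N : ℝ, κ ≤ 1 / N ^ 2 → 1 ≤ N → c < d → d ≤ 2 * c → d ≤ N * (d - c) →
        h' / 2 ≤ d - c → i * h' ≤ c → d ≤ (i + 1) * h' →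
        ∃ e f : ℝ, Ico e f ⊆ Ico (((0 : ℤ) : ℝ) * h + i * h') (((0 : ℤ) : ℝ) * h + (i + 1) * h') ∧
          κ * h ≤ f - e ∧ ∀ z ∈ Ico e f, κ * 1 ≤ bumpWeight p η z := by
      intro c d N hκN hN hcd h2 hdN hlen hc hd
      obtain ⟨j, hj⟩ := bumpWeight_eqOn hp hlac hη0 hη1 h2
      obtain ⟨e, f, he, hf, hef, hb⟩ := exists_quarter_bump_ge (hp j) (hη1 j) hN hcd hdN
      refine ⟨e, f, ?_, by linarith, fun z hz => ?_⟩
      · apply Ico_subset_Ico <;> push_cast <;> linarith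
      · rw [hj z ⟨he.trans hz.1, hz.2.trans_le hf⟩, mul_one]
        exact hκN.trans (hb z hz)
    rcases Nat.eq_zero_or_pos i with rfl | hi0
    · apply main (h' / 2) h' 2 hκ4 <;> norm_num <;> linarith
    · have hi1 : (1 : ℝ) ≤ i := by exact_mod_cast hi0
      have hin : (i : ℝ) + 1 ≤ n := by exact_mod_cast hi
      apply main (i * h') ((i + 1) * h') n hκn <;> nlinarith
  · have hk1 : (1 : ℝ) ≤ k := by exact_mod_cast hk
    obtain ⟨j, hj⟩ := bumpWeight_eqOn hp hlac hη0 hη1 (c := k * h) (d := (k + 1) * h)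
      (by nlinarith)
    obtain ⟨a, ha1, ha2⟩ := hx j
    have hside : (k + 1) * h ≤ p j + η j * (p j / 8) ∨ p j ≤ k * h := by
      rcases adicInterval_side hn t hk a with h1 | h1
      · exact Or.inr (ha1.trans h1)
      · exact Or.inl (h1.trans ha2)
    obtain ⟨M, hM, hc⟩ := bump_flat (hp j) (hη0 j) (hη1 j) (by linarith : 1 ≤ (n : ℝ)) hside
      (by nlinarith)
    refine ⟨M, fun z hz => ?_, fun i hi => ?_⟩
    · rw [adicInterval_eq] at hz
      rw [hj z hz]
      exact hM z hz
    · have hin : (i : ℝ) + 1 ≤ n := by exact_mod_cast hi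
      have hi0 : (0 : ℝ) ≤ i := by positivity
      obtain ⟨e, f, he, hf, hef, hb⟩ := hc (k * h + i * h') (k * h + (i + 1) * h')
        (by nlinarith) (by nlinarith) (by nlinarith)
      have hs := adicInterval_child_subset hn t k hi
      have hs' : Ico e f ⊆ adicInterval n (t + 1) ((n : ℤ) * k + (i : ℤ)) := by
        rw [adicInterval_child_eq hn]
        exact Ico_subset_Ico he hf
      refine ⟨e, f, hs', by linarith, fun z hz => ?_⟩
      have hz' := hs (hs' hz)
      rw [adicInterval_eq] at hz'
      rw [hj z hz']
      exact hb z hz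

end Weight

/-! ### Failure of the reverse Hölder inequality -/

/-- The interval `[p - ρ³ p / 8, p + ρ² p / 8)` tests a bump with floor `ρ ^ 4`: on the long right
part the bump is at its floor, while the short left part carries a comparable mass, spread over a
proportion `ρ` of the interval. -/
lemma ReverseHolderOn.le_of_eqOn_bump {w : ℝ → ℝ} (hm : Measurable w) (hw0 : ∀ z, 0 < w z)
    (hw1 : ∀ z, w z ≤ 1) {p ρ r C : ℝ} (hp : 0 < p) (hρ : 0 < ρ) (hρ1 : ρ ≤ 1) (hr : 1 < r)
    (heq : ∀ z ∈ Ico (p - ρ ^ 3 * (p / 8)) (p + ρ ^ 2 * (p / 8)), w z = bump p (ρ ^ 4) z)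
    (h : ReverseHolderOn w r C (Ico (p - ρ ^ 3 * (p / 8)) (p + ρ ^ 2 * (p / 8)))) :
    (ρ / 4) ^ (1 / r) ≤ 4 * |C| * ρ := by
  set L := p / 8 with hL
  have hL0 : 0 < L := by positivity
  set a := p - ρ ^ 3 * L with ha
  set b := p + ρ ^ 2 * L with hb
  have h3 : 0 < ρ ^ 3 * L := by positivity
  have h2 : 0 < ρ ^ 2 * L := by positivity
  have hρ32 : ρ ^ 3 ≤ ρ ^ 2 := pow_le_pow_of_le_one hρ.le hρ1 (by norm_num)
  have hρ43 : ρ ^ 4 ≤ ρ ^ 3 := pow_le_pow_of_le_one hρ.le hρ1 (by norm_num)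
  have hab : a < b := by linarith
  have hlen : b - a ≤ 2 * (ρ ^ 2 * L) := by nlinarith
  have hlen' : ρ ^ 2 * L ≤ b - a := by linarith
  have hint := fun c d => integrableOn_Ico_of_le_one hm hw0 hw1 c d
  obtain ⟨-, h⟩ := h
  rw [setAverage_Ico hab, setAverage_Ico hab] at h
  have up : ∫ x in Ico a b, w x ≤ 2 * ρ ^ 6 * L := by
    have e1 : ∫ x in Ico a p, w x ≤ ρ ^ 3 * (p - a) := by
      refine setIntegral_Ico_le (by linarith) (fun z hz => ?_) (hint _ _)
      rw [heq z ⟨hz.1, hz.2.trans (by linarith)⟩, bump_of_lt _ hz.2]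
      refine max_le hρ43 (min_le_of_right_le ?_)
      rw [div_le_iff₀ hL0]
      linarith [hz.1]
    have e2 : ∫ x in Ico p b, w x ≤ ρ ^ 4 * (b - p) := by
      refine setIntegral_Ico_le (by linarith) (fun z hz => ?_) (hint _ _)
      rw [heq z ⟨le_trans (by linarith) hz.1, hz.2⟩, bump_of_le _ hz.1]
      refine max_le le_rfl (min_le_of_right_le ?_)
      have : (z - p) / L ≤ ρ ^ 2 := by
        rw [div_le_iff₀ hL0]
        linarith [hz.2]
      calc ((z - p) / L) ^ 2 ≤ (ρ ^ 2) ^ 2 := by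
            have : 0 ≤ z - p := by linarith [hz.1]
            gcongr
        _ = ρ ^ 4 := by ring
    rw [← Ico_union_Ico_eq_Ico (by linarith : a ≤ p) (by linarith : p ≤ b),
      setIntegral_union (Ico_disjoint_Ico_same) measurableSet_Ico (hint _ _) (hint _ _)]
    have e3 : ρ ^ 3 * (p - a) = ρ ^ 6 * L := by rw [ha]; ring
    have e4 : ρ ^ 4 * (b - p) = ρ ^ 6 * L := by rw [hb]; ring
    linarith
  have low : (ρ ^ 3 / 2) ^ r * (ρ ^ 3 * L / 2) ≤ ∫ x in Ico a b, w x ^ r := by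
    have := le_setIntegral_Ico (w := fun x => w x ^ r) (a := a) (b := b) (e := a)
      (f := a + ρ ^ 3 * L / 2) (c := (ρ ^ 3 / 2) ^ r) (by linarith)
      (Ico_subset_Ico le_rfl (by linarith)) (fun z => (Real.rpow_pos_of_pos (hw0 z) r).le)
      (fun z hz => ?_) (integrableOn_rpow_Ico_of_le_one hm hw0 hw1 (by linarith) _ _)
    · linarith
    · refine Real.rpow_le_rpow (by positivity) ?_ (by linarith)
      have hzp : z < p := by linarith [hz.2]
      rw [heq z ⟨hz.1, by linarith⟩, bump_of_lt _ hzp]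
      refine le_max_of_le_right (le_min ?_ ?_)
      · have : ρ ^ 3 ≤ 1 := pow_le_one₀ hρ.le hρ1
        linarith
      · rw [← hL, le_div_iff₀ hL0]
        linarith [hz.2]
  have hI0 : 0 ≤ ∫ x in Ico a b, w x := integral_nonneg fun z => (hw0 z).le
  have rhs : C * ((b - a)⁻¹ * ∫ x in Ico a b, w x) ≤ |C| * (2 * ρ ^ 4) := by
    have hba : 0 < b - a := by linarith
    refine mul_le_mul (le_abs_self C) ?_ (by positivity) (abs_nonneg C)
    rw [inv_mul_le_iff₀ hba]
    nlinarith [pow_pos hρ 4]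
  have lhs : (ρ / 4) ^ (1 / r) * (ρ ^ 3 / 2) ≤
      ((b - a)⁻¹ * ∫ x in Ico a b, w x ^ r) ^ (1 / r) := by
    have e : (ρ / 4) ^ (1 / r) * (ρ ^ 3 / 2) = (ρ / 4 * (ρ ^ 3 / 2) ^ r) ^ (1 / r) := by
      rw [Real.mul_rpow (by positivity) (by positivity), ← Real.rpow_mul (by positivity),
        mul_one_div_cancel (by linarith), Real.rpow_one]
    rw [e]
    refine Real.rpow_le_rpow (by positivity) ?_ (by positivity)
    rw [← div_eq_inv_mul, le_div_iff₀ (by linarith)]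
    refine le_trans ?_ low
    have hA : 0 < (ρ ^ 3 / 2) ^ r := by positivity
    calc ρ / 4 * (ρ ^ 3 / 2) ^ r * (b - a)
        ≤ ρ / 4 * (ρ ^ 3 / 2) ^ r * (2 * (ρ ^ 2 * L)) := by gcongr
      _ = _ := by ring
  have fin := lhs.trans (h.trans rhs)
  have h30 : 0 < ρ ^ 3 / 2 := by positivity
  refine le_of_mul_le_mul_right (fin.trans_eq ?_) h30
  ring

/-- A family of bumps whose floors tend to zero violates every reverse Hölder inequality. -/
theorem bumpWeight_notMem_RH {p : ℕ → ℝ} {η : ℕ → ℝ} (hη : ∀ k, η k = (1 / ((k : ℝ) + 2)) ^ 4)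
    (hp : ∀ k, 0 < p k) (hp1 : ∀ k, p k ≤ 1 / 2) (hlac : ∀ k l, k < l → p l ≤ p k / 4)
    (hη0 : ∀ k, 0 < η k) (hη1 : ∀ k, η k ≤ 1) {J : Set ℝ} (hJ : Ico 0 1 ⊆ J) {r : ℝ}
    (hr : 1 < r) : bumpWeight p η ∉ RH J r := by
  rintro ⟨-, C, hC⟩
  have hs : 0 < 1 - 1 / r := by
    rw [sub_pos, div_lt_one (by linarith)]; exact hr
  have hbound (k : ℕ) : ((k : ℝ) + 2) ^ (1 - 1 / r) ≤ 16 * |C| := by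
    have hk : (0 : ℝ) < (k : ℝ) + 2 := by positivity
    set ρ : ℝ := 1 / ((k : ℝ) + 2) with hρ
    have hρ0 : 0 < ρ := by positivity
    have hρ1 : ρ ≤ 1 := by
      rw [hρ, div_le_one hk]
      linarith [(Nat.cast_nonneg k : (0 : ℝ) ≤ k)]
    have hρ2 : ρ ^ 2 ≤ 1 := pow_le_one₀ hρ0.le hρ1
    have hρ3 : ρ ^ 3 ≤ 1 := pow_le_one₀ hρ0.le hρ1
    have hpk := hp k
    have hpk1 := hp1 k
    set a := p k - ρ ^ 3 * (p k / 8) with ha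
    set b := p k + ρ ^ 2 * (p k / 8) with hb
    have ha' : 7 / 8 * p k ≤ a := by nlinarith
    have hb' : b ≤ 9 / 8 * p k := by nlinarith
    have hab : a < b := by
      have : 0 < ρ ^ 3 * (p k / 8) := by positivity
      have : 0 < ρ ^ 2 * (p k / 8) := by positivity
      linarith
    obtain ⟨j, hj⟩ := bumpWeight_eqOn hp hlac hη0 hη1 (by linarith : b ≤ 2 * a)
    have heq : ∀ z ∈ Ico a b, bumpWeight p η z = bump (p k) (ρ ^ 4) z := by
      intro z hz
      rw [← hη k]
      refine bumpWeight_eq_bump hη0 hη1 fun l hl => bump_eq_one (hp l) (hη1 l) ?_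
      rcases lt_or_gt_of_ne hl with h | h
      · have := hlac l k h
        refine le_trans ?_ (neg_le_abs _)
        linarith [hz.2]
      · have := hlac k l h
        refine le_trans ?_ (le_abs_self _)
        linarith [hz.1]
    have key := ReverseHolderOn.le_of_eqOn_bump measurable_bumpWeight
      (bumpWeight_pos hp hlac hη0 hη1) (bumpWeight_le_one hη0 hη1) hpk hρ0 hρ1 hr heq
      (hC a b hab ((Ico_subset_Ico (by linarith) (by linarith)).trans hJ))
    have e1 : ρ ^ (1 / r) = ρ * ((k : ℝ) + 2) ^ (1 - 1 / r) := by
      have : ((k : ℝ) + 2) = ρ⁻¹ := by rw [hρ, one_div, inv_inv]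
      rw [this, Real.inv_rpow hρ0.le, ← Real.rpow_neg hρ0.le]
      nth_rw 2 [← Real.rpow_one ρ]
      rw [← Real.rpow_add hρ0]
      ring_nf
    have e3 : (1 / 4 : ℝ) ≤ (1 / 4 : ℝ) ^ (1 / r) := by
      conv_lhs => rw [← Real.rpow_one (1 / 4 : ℝ)]
      exact Real.rpow_le_rpow_of_exponent_ge (by norm_num) (by norm_num) (by linarith)
    have e4 : ρ * (((k : ℝ) + 2) ^ (1 - 1 / r) * (1 / 4)) ≤ ρ * (4 * |C|) := by
      calc _ = ρ ^ (1 / r) * (1 / 4) := by rw [e1]; ring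
        _ ≤ ρ ^ (1 / r) * (1 / 4) ^ (1 / r) := by gcongr
        _ = (ρ / 4) ^ (1 / r) := by
          rw [← Real.mul_rpow hρ0.le (by norm_num), mul_one_div]
        _ ≤ _ := by linarith
    have := le_of_mul_le_mul_left e4 hρ0
    linarith
  have hlim : Filter.Tendsto (fun k : ℕ => ((k : ℝ) + 2) ^ (1 - 1 / r)) Filter.atTop
      Filter.atTop :=
    (tendsto_rpow_atTop hs).comp
      (Filter.tendsto_atTop_add_const_right _ _ tendsto_natCast_atTop_atTop)
  obtain ⟨k, hk⟩ := (hlim.eventually_gt_atTop (16 * |C|)).exists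
  exact (hbound k).not_gt hk

/-! ### Nearly equal powers -/

/-- By Dirichlet's approximation theorem for `log n / log m`, there are arbitrarily small powers
`n ^ (-a)` and `m ^ (-b)` whose ratio is arbitrarily close to one. -/
lemma exists_close_powers {m n : ℕ} (hm : 2 ≤ m) (hn : 2 ≤ n) {ε B : ℝ} (hε : 0 < ε)
    (hB : 0 < B) : ∃ p : ℝ, 0 < p ∧ p ≤ B ∧
      (∃ a : ℕ, p ≤ 1 / (n : ℝ) ^ a ∧ 1 / (n : ℝ) ^ a ≤ p * (1 + ε)) ∧
      ∃ b : ℕ, p ≤ 1 / (m : ℝ) ^ b ∧ 1 / (m : ℝ) ^ b ≤ p * (1 + ε) := by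
  have hm0 : (0 : ℝ) < m := by positivity
  have hn0 : (0 : ℝ) < n := by positivity
  have hn2 : (2 : ℝ) ≤ n := by exact_mod_cast hn
  have hlm : 0 < Real.log m := Real.log_pos (by exact_mod_cast hm)
  have hln : 0 < Real.log n := Real.log_pos (by exact_mod_cast hn)
  have hle : 0 < Real.log (1 + ε) := Real.log_pos (by linarith)
  obtain ⟨S, hS⟩ := exists_pow_lt_of_lt_one hB (by norm_num : (1 / 2 : ℝ) < 1)
  obtain ⟨N, hN⟩ := exists_nat_gt (S * Real.log m / Real.log (1 + ε))
  set ξ := Real.log n / Real.log m with hξ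
  obtain ⟨q, hq0, -, hq⟩ := Real.exists_nat_abs_mul_sub_round_le ξ (Nat.succ_pos N)
  obtain ⟨s, hs⟩ : ∃ s : ℕ, round (q * ξ) = s := by
    refine ⟨(round (q * ξ)).toNat, (Int.toNat_of_nonneg ?_).symm⟩
    rw [round_eq]
    exact Int.floor_nonneg.2 (by positivity)
  rw [hs] at hq
  -- Multiplying both exponents by `S` makes the powers small.
  have hlog : |(S * q : ℕ) * Real.log n - (S * s : ℕ) * Real.log m| ≤ Real.log (1 + ε) := by
    have e : ((S * q : ℕ) : ℝ) * Real.log n - (S * s : ℕ) * Real.log m =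
        S * Real.log m * (q * ξ - ((s : ℤ) : ℝ)) := by
      rw [hξ]; push_cast; field_simp
    rw [e, abs_mul, abs_of_nonneg (by positivity)]
    have h1 : S * Real.log m ≤ N * Real.log (1 + ε) := by
      rw [div_lt_iff₀ hle] at hN; exact hN.le
    calc _ ≤ N * Real.log (1 + ε) * (1 / (((N.succ : ℕ) : ℝ) + 1)) := by gcongr
      _ ≤ _ := by
        rw [mul_one_div, div_le_iff₀ (by positivity)]
        push_cast
        nlinarith
  have hx : (1 : ℝ) / (n : ℝ) ^ (S * q) = Real.exp (-((S * q : ℕ) * Real.log n)) := by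
    rw [Real.exp_neg, Real.exp_nat_mul, Real.exp_log hn0, one_div]
  have hy : (1 : ℝ) / (m : ℝ) ^ (S * s) = Real.exp (-((S * s : ℕ) * Real.log m)) := by
    rw [Real.exp_neg, Real.exp_nat_mul, Real.exp_log hm0, one_div]
  have hε1 : 1 + ε = Real.exp (Real.log (1 + ε)) := (Real.exp_log (by linarith)).symm
  have hxB : (1 : ℝ) / (n : ℝ) ^ (S * q) ≤ B := by
    refine le_trans ?_ hS.le
    rw [one_div_pow]
    refine one_div_le_one_div_of_le (by positivity) ?_
    calc (2 : ℝ) ^ S ≤ (n : ℝ) ^ S := by gcongr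
      _ ≤ _ := pow_le_pow_right₀ (by linarith) (Nat.le_mul_of_pos_right S hq0)
  obtain ⟨hl1, hl2⟩ := abs_le.1 hlog
  have hxy : (1 : ℝ) / (n : ℝ) ^ (S * q) ≤ 1 / (m : ℝ) ^ (S * s) * (1 + ε) := by
    rw [hx, hy, hε1, ← Real.exp_add, Real.exp_le_exp]; linarith
  have hyx : (1 : ℝ) / (m : ℝ) ^ (S * s) ≤ 1 / (n : ℝ) ^ (S * q) * (1 + ε) := by
    rw [hx, hy, hε1, ← Real.exp_add, Real.exp_le_exp]; linarith
  have hx0 : (0 : ℝ) < 1 / (n : ℝ) ^ (S * q) := by positivity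
  have hy0 : (0 : ℝ) < 1 / (m : ℝ) ^ (S * s) := by positivity
  rcases le_total ((1 : ℝ) / (n : ℝ) ^ (S * q)) (1 / (m : ℝ) ^ (S * s)) with h | h
  · exact ⟨_, hx0, hxB, ⟨S * q, le_rfl, by nlinarith⟩, ⟨S * s, h, hyx⟩⟩
  · exact ⟨_, hy0, h.trans hxB, ⟨S * q, h, hxy⟩, ⟨S * s, le_rfl, by nlinarith⟩⟩

lemma exists_lacunary_close_powers {m n : ℕ} (hm : 2 ≤ m) (hn : 2 ≤ n) {η : ℕ → ℝ}
    (hη0 : ∀ k, 0 < η k) : ∃ p : ℕ → ℝ, (∀ k, 0 < p k) ∧ (∀ k, p k ≤ 1 / 2) ∧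
      (∀ k l, k < l → p l ≤ p k / 4) ∧
      (∀ k, ∃ a : ℕ, p k ≤ 1 / (n : ℝ) ^ a ∧ 1 / (n : ℝ) ^ a ≤ p k + η k * (p k / 8)) ∧
      ∀ k, ∃ b : ℕ, p k ≤ 1 / (m : ℝ) ^ b ∧ 1 / (m : ℝ) ^ b ≤ p k + η k * (p k / 8) := by
  choose F hF0 hFB hFn hFm using fun (k : ℕ) (B : {B : ℝ // 0 < B}) =>
    exists_close_powers hm hn (div_pos (hη0 k) (by norm_num : (0 : ℝ) < 8)) B.2
  -- The recursion carries the bound imposed on the next point.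
  let B : ℕ → {B : ℝ // 0 < B} := fun k => Nat.rec ⟨1 / 2, by norm_num⟩
    (fun k B => ⟨F k B / 4, div_pos (hF0 k B) (by norm_num)⟩) k
  have hstep (k : ℕ) : F (k + 1) (B (k + 1)) ≤ F k (B k) / 4 := hFB (k + 1) (B (k + 1))
  have hanti : Antitone fun k => F k (B k) :=
    antitone_nat_of_succ_le fun k => by linarith [hstep k, hF0 k (B k)]
  refine ⟨fun k => F k (B k), fun k => hF0 _ _, fun k => (hanti k.zero_le).trans (hFB 0 (B 0)),
    fun k l hkl => (hanti (Nat.succ_le_of_lt hkl)).trans (hstep k), fun k => ?_, fun k => ?_⟩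
  · obtain ⟨a, h1, h2⟩ := hFn k (B k)
    exact ⟨a, h1, h2.trans_eq (by ring)⟩
  · obtain ⟨b, h1, h2⟩ := hFm k (B k)
    exact ⟨b, h1, h2.trans_eq (by ring)⟩

/-- One weight serves for all exponents and for both underlying sets. -/
theorem exists_adic_not_reverseHolder {m n : ℕ} (hm : 2 ≤ m) (hn : 2 ≤ n) {J : Set ℝ}
    (hJ : Ico 0 1 ⊆ J) : ∃ w : ℝ → ℝ, ∀ r : ℝ, 1 < r →
      w ∈ RHAdic m J r ∧ w ∈ RHAdic n J r ∧ w ∉ RH J r := by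
  let η : ℕ → ℝ := fun k => (1 / ((k : ℝ) + 2)) ^ 4
  have hη0 (k : ℕ) : 0 < η k := by positivity
  have hη1 (k : ℕ) : η k ≤ 1 := by
    refine pow_le_one₀ (by positivity) ?_
    rw [div_le_one (by positivity)]
    linarith [(Nat.cast_nonneg k : (0 : ℝ) ≤ k)]
  obtain ⟨p, hp, hp1, hlac, hpn, hpm⟩ := exists_lacunary_close_powers hm hn hη0
  have hpos := bumpWeight_pos hp hlac hη0 hη1
  have hle := bumpWeight_le_one (p := p) hη0 hη1
  refine ⟨bumpWeight p η, fun r hr => ⟨?_, ?_, ?_⟩⟩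
  · exact (isAdicFlat_bumpWeight hp hlac hη0 hη1 hm hpm).mem_RHAdic hm (by positivity)
      measurable_bumpWeight hpos hle J hr
  · exact (isAdicFlat_bumpWeight hp hlac hη0 hη1 hn hpn).mem_RHAdic hn (by positivity)
      measurable_bumpWeight hpos hle J hr
  · exact bumpWeight_notMem_RH (fun _ => rfl) hp hp1 hlac hη0 hη1 hJ hr

theorem corollary3p3 (m n : ℕ) (hm : 2 ≤ m) (hn : 2 ≤ n) (hmn : Nat.Coprime m n)
    (J : Set ℝ) (hJ : J = Set.univ ∨ J = Set.Ico (0 : ℝ) 1) :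
    (∀ r : ℝ, 1 < r → RHAdic m J r ∩ RHAdic n J r ≠ RH J r) ∧
      RHAdicOne m J ∩ RHAdicOne n J ≠ RHOne J := by
  have hJ' : Ico (0 : ℝ) 1 ⊆ J := by
    rcases hJ with rfl | rfl
    · exact subset_univ _
    · exact subset_rfl
  obtain ⟨w, hw⟩ := exists_adic_not_reverseHolder hm hn hJ'
  refine ⟨fun r hr h => ?_, fun h => ?_⟩
  · obtain ⟨h1, h2, h3⟩ := hw r hr
    exact h3 (h ▸ ⟨h1, h2⟩)
  · obtain ⟨h1, h2, -⟩ := hw 2 one_lt_two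
    have h4 : w ∈ RHOne J := h ▸ ⟨mem_biUnion (mem_Ioi.2 one_lt_two) h1,
      mem_biUnion (mem_Ioi.2 one_lt_two) h2⟩
    obtain ⟨r, hr, h5⟩ := mem_iUnion₂.1 h4
    exact (hw r hr).2.2 h5
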